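/- Let $G$ be a group with identity element $e$ and let $\Sigma$ be a finite alphabet. A finite automaton over $G$ (or $G$-automaton) with input alphabet $\Sigma$ is a tuple $(Q,\Sigma,G,\delta,q_1,Q_a)$, where $Q$ is a finite set of states, $q_1\in Q$ is the initial state, $Q_a\subseteq Q$ is the set of accept states, and the transition function $\delta$ assigns to every pair in $Q\times(\Sigma\cup\{\varepsilon\})$ a finite subset of $Q\times G$. If $(q',g)\in\delta(q,\sigma)$, then in state $q$ the automaton may read $\sigma$ (reading no input symbol if $\sigma=\varepsilon$), move to state $q'$ and replace the content $x$ of its register by $xg$. A word $w\in\Sigma^*$ is accepted if some computation that starts in $q_1$ with register content $e$ and reads exactly $w$ ends in an accept state with register content $e$. The language recognized by the automaton is the set of all accepted words. Let $\mathfrak{L}(G)$ denote the class of languages recognized by $G$-automata, and let $\mathsf{CF}$ denote the class of context-free languages, i.e. of the languages generated by context-free grammars. Let $\mathbf{F}_2$ be the free group of rank $2$, let $GL(2,\mathbb{Z})$ be the group of invertible $2\times 2$ integer matrices, and let $SL(2,\mathbb{Z})$ be its subgroup of matrices of determinant $1$. Then $$\mathsf{CF}=\mathfrak{L}(\mathbf{F}_2)=\mathfrak{L}(SL(2,\mathbb{Z}))=\mathfrak{L}(GL(2,\mathbb{Z})),$$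 that is, over every finite alphabet these four classes contain the same languages. -/

import Mathlib

/-!
The register of an automaton over a free group behaves like a stack: a computation that multiplies
the register letter by letter returns it to `1` exactly when the letters cancel in pairs, like
brackets. The words read along such a computation from the state `p` to the state `q` are generated
by a context-free grammar with the pairs `(p, q)` as nonterminals. Conversely, a recursive descent
parser for a grammar stores its return addresses in the register, one free generator for each of
them, and a free group of countable rank embeds into the free group of rank `2`.

An automaton over a group can be simulated over a subgroup of finite index, because the coset of the
register fits into the finite control. This applies to the Sanov subgroup of `SL(2, ℤ)`, which is
free of rank `2` by ping-pong and of finite index because it contains `Γ(4)`, and to the subgroup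
`SL(2, ℤ)` of `GL(2, ℤ)`.
-/

/-- A nondeterministic extended finite automaton over the group `G` with input alphabet `α` and
states `Q`: `(q', g) ∈ step q a` means that in state `q`, reading the letter `a` (or nothing, when
`a = none`), the machine may move to `q'` and multiply its register by `g` on the right.
An automaton is a finite object: it has finitely many transitions, hence the `Finset`. Finiteness
of `Q` and of `α` is required where languages and classes of languages are considered. -/
structure ExtendedFA (G α Q : Type*) where
  /-- Transition function. -/
  step : Q → Option α → Finset (Q × G)
  /-- Initial state. -/
  start : Q
  /-- Accept states. -/
  accept : Set Q

namespace ExtendedFA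

/-- `M.Run q x w r y`: some computation of `M` leads from state `q` with register content `x` to
state `r` with register content `y` while consuming exactly the word `w`. -/
inductive Run {G α Q : Type*} [Group G] (M : ExtendedFA G α Q) :
    Q → G → List α → Q → G → Prop
  | refl (q : Q) (x : G) : Run M q x [] q x
  | eps {q q' r : Q} {x g y : G} {w : List α} (h : (q', g) ∈ M.step q none)
      (hr : Run M q' (x * g) w r y) : Run M q x w r y
  | read {q q' r : Q} {x g y : G} {a : α} {w : List α} (h : (q', g) ∈ M.step q (some a))
      (hr : Run M q' (x * g) w r y) : Run M q x (a :: w) r y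

/-- The language recognized by `M`: the words that can be consumed completely by a computation
which starts in the initial state with register `1` and ends in an accept state with register
`1`. -/
def accepts {G α Q : Type*} [Group G] (M : ExtendedFA G α Q) : Language α :=
  {w | ∃ q ∈ M.accept, M.Run M.start 1 w q 1}

end ExtendedFA

/-- The class `𝔏(G)`, over the alphabet `α`: the languages recognized by extended finite automata
over `G` with finitely many states. -/
def groupAutomatonLanguages (G : Type*) [Group G] (α : Type*) : Set (Language α) :=
  {L | ∃ (Q : Type) (_ : Finite Q) (M : ExtendedFA G α Q), M.accepts = L}

/-- The class `CF`, over the alphabet `α`: the languages generated by context-free grammars. -/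
def contextFreeLanguages (α : Type*) : Set (Language α) :=
  {L | L.IsContextFree}

/-! ### Change of the register group -/

namespace ExtendedFA

variable {G H α P Q : Type*} [Group G] [Group H]

theorem Run.step {M : ExtendedFA G α Q} {q q' r : Q} {x g y : G} {σ : Option α} {w : List α}
    (h : (q', g) ∈ M.step q σ) (hr : M.Run q' (x * g) w r y) : M.Run q x (σ.toList ++ w) r y :=
  match σ, h with
  | none, h => .eps h hr
  | some _, h => .read h hr

@[elab_as_elim]
theorem Run.step_induction_on {M : ExtendedFA G α Q} {r : Q} {y : G}
    {motive : ∀ q x w, M.Run q x w r y → Prop} {q : Q} {x : G} {w : List α}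
    (h : M.Run q x w r y) (refl : motive r y [] (.refl r y))
    (step : ∀ {q q' x g σ w} (h : (q', g) ∈ M.step q σ) (hr : M.Run q' (x * g) w r y),
      motive q' (x * g) w hr → motive q x (σ.toList ++ w) (hr.step h)) :
    motive q x w h := by
  induction h with
  | refl => exact refl
  | eps h hr ih => exact step (σ := none) h hr (ih refl step)
  | read h hr ih => exact step (σ := some _) h hr (ih refl step)

/-- `M.Moves σ c d`: a single transition of `M` with label `σ` leads from the configuration `c` to
the configuration `d`, where a configuration consists of a state and the content of the register. -/
def Moves (M : ExtendedFA G α Q) (σ : Option α) (c d : Q × G) : Prop :=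
  ∃ g, (d.1, g) ∈ M.step c.1 σ ∧ d.2 = c.2 * g

theorem run_iff_of_moves_iff {M : ExtendedFA G α Q} {N : ExtendedFA H α P} {e : P × H → Q × G}
    (he : ∀ σ c d, M.Moves σ (e c) d ↔ ∃ d', N.Moves σ c d' ∧ e d' = d) {c : P × H} {d : Q × G}
    {w : List α} :
    M.Run (e c).1 (e c).2 w d.1 d.2 ↔ ∃ d', N.Run c.1 c.2 w d'.1 d'.2 ∧ e d' = d := by
  constructor
  · intro h
    generalize hc : e c = c' at h
    obtain ⟨q, x⟩ := c'
    obtain ⟨r, y⟩ := d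
    dsimp only at h
    induction h using Run.step_induction_on generalizing c with
    | refl => exact ⟨c, .refl _ _, hc⟩
    | @step q q' x g σ w h _ ih =>
      obtain ⟨c₁, ⟨k, hk, hmul⟩, hc₁⟩ := (he σ c (q', x * g)).1 (hc ▸ ⟨g, h, rfl⟩)
      obtain ⟨d', hd', hed⟩ := ih hc₁
      exact ⟨d', .step hk (hmul ▸ hd'), hed⟩
  · rintro ⟨⟨p, y⟩, h, rfl⟩
    obtain ⟨p₀, x⟩ := c
    dsimp only at h
    induction h using Run.step_induction_on with
    | refl => exact .refl _ _
    | @step p₀ p₁ x k σ w h _ ih =>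
      obtain ⟨g, hg, hmul⟩ := (he σ (p₀, x) (e (p₁, x * k))).2 ⟨_, ⟨k, h, rfl⟩, rfl⟩
      exact .step hg (hmul ▸ ih)

theorem accepts_eq_of_moves_iff {M : ExtendedFA G α Q} {N : ExtendedFA H α P} {e : P × H → Q × G}
    (he : ∀ σ c d, M.Moves σ (e c) d ↔ ∃ d', N.Moves σ c d' ∧ e d' = d)
    (hstart : e (N.start, 1) = (M.start, 1))
    (haccept : ∀ c, (e c).1 ∈ M.accept ∧ (e c).2 = 1 ↔ c.1 ∈ N.accept ∧ c.2 = 1) :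
    M.accepts = N.accepts := by
  ext w
  have hrun (d : Q × G) :
      M.Run M.start 1 w d.1 d.2 ↔ ∃ d', N.Run N.start 1 w d'.1 d'.2 ∧ e d' = d := by
    simpa only [hstart] using run_iff_of_moves_iff he (c := (N.start, 1)) (d := d)
  constructor
  · rintro ⟨q, hq, h⟩
    obtain ⟨d', hd', hed⟩ := (hrun (q, 1)).1 h
    obtain ⟨hd₁, hd₂⟩ := (haccept d').1 (by rw [hed]; exact ⟨hq, rfl⟩)
    exact ⟨d'.1, hd₁, hd₂ ▸ hd'⟩
  · rintro ⟨p, hp, h⟩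
    obtain ⟨hp₁, hp₂⟩ := (haccept (p, 1)).2 ⟨hp, rfl⟩
    exact ⟨(e (p, 1)).1, hp₁, hp₂ ▸ (hrun (e (p, 1))).2 ⟨_, h, rfl⟩⟩

/-- The automaton `M` with its states renamed along `ε` and its register embedded into `H`. -/
def map (M : ExtendedFA G α Q) (ε : Q ≃ P) (f : G →* H) (hf : Function.Injective f) :
    ExtendedFA H α P where
  step p σ := (M.step (ε.symm p) σ).map (ε.toEmbedding.prodMap ⟨f, hf⟩)
  start := ε M.start
  accept := ε.symm ⁻¹' M.accept

theorem accepts_map (M : ExtendedFA G α Q) (ε : Q ≃ P) {f : G →* H} (hf : Function.Injective f) :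
    (M.map ε f hf).accepts = M.accepts := by
  refine accepts_eq_of_moves_iff (e := Prod.map ε f) ?_ (by simp [map]) fun c => ?_
  · rintro σ ⟨q, x⟩ ⟨p, y⟩
    simp only [Moves, map, Finset.mem_map]
    constructor
    · rintro ⟨_, ⟨⟨q', g⟩, hg, hqg⟩, rfl⟩
      obtain ⟨rfl, rfl⟩ := Prod.mk.inj hqg
      exact ⟨(q', x * g), ⟨g, by simpa using hg, rfl⟩, by simp⟩
    · rintro ⟨⟨q', _⟩, ⟨g, hg, rfl⟩, hqg⟩
      obtain ⟨rfl, rfl⟩ := Prod.mk.inj hqg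
      exact ⟨f g, ⟨(q', g), by simpa using hg, rfl⟩, by simp⟩
  · simp [map, map_eq_one_iff f hf]

theorem accepts_mem_groupAutomatonLanguages [Finite Q] (M : ExtendedFA G α Q) :
    M.accepts ∈ groupAutomatonLanguages G α :=
  ⟨Fin (Nat.card Q), inferInstance,
    M.map (Finite.equivFin Q) (MonoidHom.id G) Function.injective_id, M.accepts_map _ _⟩

open scoped Classical in
/-- For a right transversal `T` of the subgroup `K`, the automaton over `K` that simulates `M`: when
the register of `M` contains `k * t` with `k : K` and `t : T`, it keeps `k` in its register and `t`
in its finite control. -/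
noncomputable def restrict (M : ExtendedFA G α Q) {K : Subgroup G} {T : Set G}
    (hT : Subgroup.IsComplement K T) (one_mem : 1 ∈ T) : ExtendedFA K α (Q × T) where
  step p σ := (M.step p.1 σ).image fun s =>
    ((s.1, (hT.equiv (p.2 * s.2)).2), (hT.equiv (p.2 * s.2)).1)
  start := (M.start, ⟨1, one_mem⟩)
  accept := {p | p.1 ∈ M.accept ∧ p.2 = ⟨1, one_mem⟩}

theorem accepts_restrict (M : ExtendedFA G α Q) {K : Subgroup G} {T : Set G}
    (hT : Subgroup.IsComplement K T) (one_mem : 1 ∈ T) :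
    (M.restrict hT one_mem).accepts = M.accepts := by
  symm
  refine accepts_eq_of_moves_iff (e := fun c => (c.1.1, c.2 * c.1.2)) ?_ (by simp [restrict]) ?_
  · rintro σ ⟨⟨q, t⟩, k⟩ ⟨q', y⟩
    simp only [Moves, restrict, Finset.mem_image]
    constructor
    · rintro ⟨g, hg, rfl⟩
      refine ⟨((q', (hT.equiv (t * g)).2), k * (hT.equiv (t * g)).1), ⟨_, ⟨_, hg, rfl⟩, rfl⟩, ?_⟩
      simp [mul_assoc, hT.equiv_fst_mul_equiv_snd]
    · rintro ⟨⟨⟨_, _⟩, _⟩, ⟨_, ⟨⟨q', g⟩, hg, hs⟩, rfl⟩, hd⟩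
      simp only [Prod.mk.injEq] at hs hd
      obtain ⟨⟨rfl, rfl⟩, rfl⟩ := hs
      obtain ⟨rfl, rfl⟩ := hd
      exact ⟨g, hg, by simp [mul_assoc, hT.equiv_fst_mul_equiv_snd]⟩
  · rintro ⟨⟨q, t⟩, k⟩
    have : (k : G) * t = 1 ↔ t = ⟨1, one_mem⟩ ∧ k = 1 := by
      refine ⟨fun h => ?_, by rintro ⟨rfl, rfl⟩; simp⟩
      have := hT.1 (a₁ := (k, t)) (a₂ := (1, ⟨1, one_mem⟩)) (by simpa using h)
      simp_all
    simp [restrict, this, and_assoc]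

end ExtendedFA

theorem groupAutomatonLanguages_subset_of_injective {G H : Type*} [Group G] [Group H] {f : G →* H}
    (hf : Function.Injective f) (α : Type*) :
    groupAutomatonLanguages G α ⊆ groupAutomatonLanguages H α := by
  rintro _ ⟨Q, hQ, M, rfl⟩
  exact ⟨Q, hQ, M.map (.refl Q) f hf, M.accepts_map _ hf⟩

theorem groupAutomatonLanguages_subset_of_finiteIndex {G : Type*} [Group G] (K : Subgroup G)
    [K.FiniteIndex] (α : Type*) : groupAutomatonLanguages G α ⊆ groupAutomatonLanguages K α := by
  rintro _ ⟨Q, hQ, M, rfl⟩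
  obtain ⟨T, hT, one_mem⟩ := K.exists_isComplement_right 1
  have : Finite T := hT.finite_right
  rw [← M.accepts_restrict hT one_mem]
  exact ExtendedFA.accepts_mem_groupAutomatonLanguages _

theorem groupAutomatonLanguages_eq_of_finiteIndex_range {G H : Type*} [Group G] [Group H]
    {f : G →* H} (hf : Function.Injective f) [f.range.FiniteIndex] (α : Type*) :
    groupAutomatonLanguages G α = groupAutomatonLanguages H α :=
  (groupAutomatonLanguages_subset_of_injective hf α).antisymm <|
    (groupAutomatonLanguages_subset_of_finiteIndex f.range α).trans <|
      groupAutomatonLanguages_subset_of_injective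
        (f := (MonoidHom.ofInjective hf).symm.toMonoidHom) (MulEquiv.injective _) α

/-! ### Automata over free groups and balanced computations -/

/-- A nondeterministic automaton whose transitions read at most one letter of the alphabet `α` and
emit at most one letter of the free group on `X`, where `(x, true)` stands for the generator `x` and
`(x, false)` for its inverse. -/
structure LetterAutomaton (α X Q : Type*) where
  /-- `Step p σ c q`: reading `σ` and emitting `c`, the automaton may move from `p` to `q`. -/
  Step : Q → Option α → Option (X × Bool) → Q → Prop
  /-- Initial state. -/
  start : Q
  /-- Accept states. -/
  accept : Set Q

namespace LetterAutomaton

variable {α X Q : Type*} {A : LetterAutomaton α X Q}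

/-- `A.Balanced p w q`: the word `w` can be read on the way from `p` to `q` in such a way that the
emitted letters cancel in pairs, like brackets. -/
inductive Balanced (A : LetterAutomaton α X Q) : Q → List α → Q → Prop
  | nil (p : Q) : Balanced A p [] p
  | silent {p p' q : Q} {σ : Option α} {w : List α} (h : A.Step p σ none p')
      (hb : Balanced A p' w q) : Balanced A p (σ.toList ++ w) q
  | pair {p p' q' q'' q : Q} {σ τ : Option α} {x : X} {b : Bool} {w w' : List α}
      (h : A.Step p σ (some (x, b)) p') (hb : Balanced A p' w q')
      (h' : A.Step q' τ (some (x, !b)) q'') (hb' : Balanced A q'' w' q) :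
      Balanced A p (σ.toList ++ w ++ τ.toList ++ w') q

/-- The words that can be read by a balanced computation from the initial state to an accept
state. -/
def language (A : LetterAutomaton α X Q) : Language α :=
  {w | ∃ q ∈ A.accept, A.Balanced A.start w q}

theorem Balanced.trans {p q r : Q} {w w' : List α} (h : A.Balanced p w q)
    (h' : A.Balanced q w' r) : A.Balanced p (w ++ w') r := by
  induction h with
  | nil => exact h'
  | silent h _ ih =>
    rw [List.append_assoc]
    exact .silent h (ih h')
  | pair h hb h₁ _ _ ih =>
    rw [List.append_assoc]
    exact .pair h hb h₁ (ih h')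

/-- `A.Emits p l w q`: the word `w` can be read on the way from `p` to `q` in such a way that the
word `l` is left over from the emitted letters once balanced subcomputations are ignored. -/
inductive Emits (A : LetterAutomaton α X Q) : Q → List (X × Bool) → List α → Q → Prop
  | balanced {p q : Q} {w : List α} (h : A.Balanced p w q) : Emits A p [] w q
  | emit {p p' p'' q : Q} {σ : Option α} {c : X × Bool} {w w' : List α} {l : List (X × Bool)}
      (hb : A.Balanced p w p') (h : A.Step p' σ (some c) p'') (he : Emits A p'' l w' q) :
      Emits A p (c :: l) (w ++ σ.toList ++ w') q

theorem Balanced.trans_emits {p q r : Q} {w w' : List α} {l : List (X × Bool)}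
    (h : A.Balanced p w q) (h' : A.Emits q l w' r) : A.Emits p l (w ++ w') r := by
  cases h' with
  | balanced hb => exact .balanced (h.trans hb)
  | emit hb hs he => simpa only [List.append_assoc] using Emits.emit (h.trans hb) hs he

theorem Emits.step [DecidableEq X] {p p' q : Q} {σ : Option α} {c : Option (X × Bool)}
    {w : List α} {g : FreeGroup X} (hs : A.Step p σ c p') (he : A.Emits p' g.toWord w q) :
    A.Emits p (FreeGroup.mk c.toList * g).toWord (σ.toList ++ w) q := by
  match c with
  | none => simpa [← FreeGroup.one_eq_mk] using (Balanced.silent hs (.nil p')).trans_emits he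
  | some (x, b) =>
    have hword : (FreeGroup.mk [(x, b)] * g).toWord = FreeGroup.reduce ((x, b) :: g.toWord) := by
      rw [FreeGroup.toWord_mul, FreeGroup.toWord_mk, FreeGroup.reduce_singleton,
        List.singleton_append]
    rw [Option.toList_some, hword, FreeGroup.reduce.cons, FreeGroup.reduce_toWord]
    generalize g.toWord = l at he
    cases he with
    | balanced hb => exact .emit (.nil p) hs (.balanced hb)
    | @emit _ p₁ p₂ _ τ c w w' l hb hs' he =>
      obtain ⟨y, b'⟩ := c
      dsimp only
      split_ifs with h
      · obtain ⟨rfl, rfl⟩ := h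
        have hpair := Balanced.pair hs hb (by rwa [Bool.not_not]) (.nil p₂)
        simpa only [List.append_assoc, List.append_nil] using hpair.trans_emits he
      · exact .emit (.nil p) hs (.emit hb hs' he)

open scoped Classical in
/-- The automaton over the free group that multiplies its register by the emitted letters. -/
noncomputable def toFA [Finite Q] [Finite X] (A : LetterAutomaton α X Q) :
    ExtendedFA (FreeGroup X) α Q where
  step p σ := (Set.toFinite {s : Q × Option (X × Bool) | A.Step p σ s.2 s.1}).toFinset.image
    fun s => (s.1, FreeGroup.mk s.2.toList)
  start := A.start
  accept := A.accept

variable [Finite Q] [Finite X]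

theorem mem_toFA_step {p q : Q} {σ : Option α} {g : FreeGroup X} :
    (q, g) ∈ A.toFA.step p σ ↔ ∃ c, A.Step p σ c q ∧ FreeGroup.mk c.toList = g := by
  simp [toFA]

theorem emits_of_toFA_run [DecidableEq X] {p q : Q} {x : FreeGroup X} {w : List α}
    (h : A.toFA.Run p x w q 1) : A.Emits p x⁻¹.toWord w q := by
  induction h using ExtendedFA.Run.step_induction_on with
  | refl => simpa using Emits.balanced (.nil q)
  | step h _ ih =>
    obtain ⟨c, hc, rfl⟩ := mem_toFA_step.1 h
    rw [mul_inv_rev] at ih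
    rw [← mul_inv_cancel_left (FreeGroup.mk c.toList) _⁻¹]
    exact .step hc ih

theorem Balanced.toFA_run {p q r : Q} {w w' : List α} (h : A.Balanced p w q) {x y : FreeGroup X}
    (hr : A.toFA.Run q x w' r y) : A.toFA.Run p x (w ++ w') r y := by
  induction h generalizing w' x with
  | nil => exact hr
  | silent h _ ih =>
    rw [List.append_assoc]
    refine .step (mem_toFA_step.2 ⟨_, h, rfl⟩) (ih ?_)
    simpa [← FreeGroup.one_eq_mk] using hr
  | @pair _ _ _ _ _ _ _ z b _ _ h _ h' _ ih ih' =>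
    simp only [List.append_assoc]
    refine .step (mem_toFA_step.2 ⟨_, h, rfl⟩) (ih (.step (mem_toFA_step.2 ⟨_, h', rfl⟩) (ih' ?_)))
    have hcancel : FreeGroup.mk [(z, b)] * FreeGroup.mk [(z, !b)] = 1 :=
      mul_inv_cancel (FreeGroup.mk [(z, b)])
    simpa [mul_assoc, hcancel] using hr

theorem accepts_toFA (A : LetterAutomaton α X Q) : A.toFA.accepts = A.language := by
  classical
  ext w
  refine exists_congr fun q => and_congr_right fun _ => ⟨fun h => ?_, fun h => ?_⟩
  · have := emits_of_toFA_run h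
    rw [inv_one, FreeGroup.toWord_one] at this
    cases this with
    | balanced hb => exact hb
  · have := h.toFA_run (.refl q 1)
    rwa [List.append_nil] at this

end LetterAutomaton

/-! ### Context-free grammars -/

section Grammar

variable {T N : Type*}

/-- The words obtained from the sentential form `s` by replacing every occurrence of a nonterminal
`A` by a word of the language `K A`. -/
def formLanguage (K : N → Language T) (s : List (Symbol T N)) : Language T :=
  (s.map fun
    | .terminal a => ({[a]} : Language T)
    | .nonterminal A => K A).prod

theorem formLanguage_append (K : N → Language T) (s t : List (Symbol T N)) :
    formLanguage K (s ++ t) = formLanguage K s * formLanguage K t := by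
  simp [formLanguage]

theorem formLanguage_cons (K : N → Language T) (x : Symbol T N) (s : List (Symbol T N)) :
    formLanguage K (x :: s) = formLanguage K [x] * formLanguage K s :=
  formLanguage_append K [x] s

theorem formLanguage_nonterminal (K : N → Language T) (A : N) :
    formLanguage K [.nonterminal A] = K A := by
  simp [formLanguage]

theorem formLanguage_terminal (K : N → Language T) (a : T) :
    formLanguage K [.terminal a] = ({[a]} : Language T) := by
  simp [formLanguage]

theorem formLanguage_map_terminal (K : N → Language T) (w : List T) :
    formLanguage K (w.map .terminal) = ({w} : Language T) := by
  induction w with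
  | nil => rfl
  | cons a w ih =>
    rw [List.map_cons, formLanguage_cons, formLanguage_terminal, ih]
    exact Set.image2_singleton

theorem formLanguage_le_of_derives {g : ContextFreeGrammar T} {K : g.NT → Language T}
    (hK : ∀ r ∈ g.rules, formLanguage K r.output ≤ K r.input) {u v : List (Symbol T g.NT)}
    (h : g.Derives u v) : formLanguage K v ≤ formLanguage K u := by
  induction h with
  | refl => exact le_rfl
  | tail _ hp ih =>
    refine le_trans ?_ ih
    obtain ⟨r, hr, hrw⟩ := hp
    obtain ⟨p, q, rfl, rfl⟩ := hrw.exists_parts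
    simp only [formLanguage_append, formLanguage_nonterminal]
    gcongr
    exact hK r hr

theorem language_le_of_formLanguage_le {g : ContextFreeGrammar T} {K : g.NT → Language T}
    (hK : ∀ r ∈ g.rules, formLanguage K r.output ≤ K r.input) : g.language ≤ K g.initial := by
  intro w hw
  have := formLanguage_le_of_derives hK hw
  rw [formLanguage_map_terminal, formLanguage_nonterminal] at this
  exact this rfl

theorem derives_output {g : ContextFreeGrammar T} {r : ContextFreeRule T g.NT}
    (hr : r ∈ g.rules) : g.Derives [.nonterminal r.input] r.output :=
  .single ⟨r, hr, .input_output⟩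

theorem finite_setOf_output_length_le (T N : Type*) [Finite T] [Finite N] (n : ℕ) :
    {r : ContextFreeRule T N | r.output.length ≤ n}.Finite := by
  have := Fintype.ofFinite T
  have := Fintype.ofFinite N
  exact .of_injOn (t := Set.univ ×ˢ {s : List (Symbol T N) | s.length ≤ n})
    (f := fun r => (r.input, r.output)) (fun r hr => ⟨trivial, hr⟩)
    (fun ⟨_, _⟩ _ ⟨_, _⟩ _ h => by simpa using h)
    (Set.finite_univ.prod (List.finite_length_le (Symbol T N) n))

end Grammar

namespace LetterAutomaton

section Grammar

variable {α X : Type*} {Q : Type}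

/-- The rules of a grammar for the language of `A`: the nonterminal `some (p, q)` generates the
words that can be read by a balanced computation from `p` to `q`, and `none` is initial. -/
inductive IsRule (A : LetterAutomaton α X Q) : ContextFreeRule α (Option (Q × Q)) → Prop
  | entry {q : Q} (hq : q ∈ A.accept) : IsRule A ⟨none, [.nonterminal (some (A.start, q))]⟩
  | nil (p : Q) : IsRule A ⟨some (p, p), []⟩
  | silent {p p' : Q} {σ : Option α} (h : A.Step p σ none p') (q : Q) :
      IsRule A ⟨some (p, q), σ.toList.map .terminal ++ [.nonterminal (some (p', q))]⟩
  | pair {p p' q' q'' : Q} {σ τ : Option α} {x : X} {b : Bool} (h : A.Step p σ (some (x, b)) p')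
      (h' : A.Step q' τ (some (x, !b)) q'') (q : Q) :
      IsRule A ⟨some (p, q), σ.toList.map .terminal ++ [.nonterminal (some (p', q'))] ++
        τ.toList.map .terminal ++ [.nonterminal (some (q'', q))]⟩

theorem IsRule.output_length_le {A : LetterAutomaton α X Q}
    {r : ContextFreeRule α (Option (Q × Q))} (h : A.IsRule r) : r.output.length ≤ 4 := by
  have hle (σ : Option α) : σ.toList.length ≤ 1 := by cases σ <;> simp
  obtain _ | _ | @⟨_, _, σ, _⟩ | @⟨_, _, _, _, σ, τ, _⟩ := h
  · simp
  · simp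
  · have := hle σ
    simp only [List.length_append, List.length_map, List.length_singleton]
    omega
  · have := hle σ
    have := hle τ
    simp only [List.length_append, List.length_map, List.length_singleton]
    omega

/-- The words that the grammar with the rules `A.IsRule` generates from a nonterminal. -/
def nonterminalLanguage (A : LetterAutomaton α X Q) : Option (Q × Q) → Language α
  | none => A.language
  | some (p, q) => {w | A.Balanced p w q}

theorem IsRule.formLanguage_le {A : LetterAutomaton α X Q}
    {r : ContextFreeRule α (Option (Q × Q))} (h : A.IsRule r) :
    formLanguage A.nonterminalLanguage r.output ≤ A.nonterminalLanguage r.input := by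
  rcases h with hq | p | ⟨h, q⟩ | ⟨h, h', q⟩
  · rw [formLanguage_nonterminal]
    exact fun w hw => ⟨_, hq, hw⟩
  · rintro _ rfl
    exact Balanced.nil p
  · rw [formLanguage_append, formLanguage_map_terminal, formLanguage_nonterminal]
    rintro _ ⟨_, rfl, w, hw, rfl⟩
    exact Balanced.silent h hw
  · simp only [formLanguage_append, formLanguage_map_terminal, formLanguage_nonterminal]
    rintro _ ⟨_, ⟨_, ⟨_, rfl, w, hw, rfl⟩, _, rfl, rfl⟩, w', hw', rfl⟩
    exact Balanced.pair h hw h' hw'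

variable [Finite α] [Finite Q]

theorem finite_setOf_isRule (A : LetterAutomaton α X Q) : {r | A.IsRule r}.Finite :=
  (finite_setOf_output_length_le _ _ 4).subset fun _ => IsRule.output_length_le

/-- The grammar with the rules `A.IsRule`. -/
noncomputable def grammar (A : LetterAutomaton α X Q) : ContextFreeGrammar α where
  NT := Option (Q × Q)
  initial := none
  rules := A.finite_setOf_isRule.toFinset

theorem mem_grammar_rules {A : LetterAutomaton α X Q} {r : ContextFreeRule α (Option (Q × Q))} :
    r ∈ A.grammar.rules ↔ A.IsRule r :=
  Set.Finite.mem_toFinset _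

theorem Balanced.derives {A : LetterAutomaton α X Q} {p q : Q} {w : List α}
    (h : A.Balanced p w q) :
    A.grammar.Derives [.nonterminal (some (p, q))] (w.map .terminal) := by
  induction h with
  | nil p => exact derives_output (mem_grammar_rules.2 (.nil p))
  | @silent p p' q σ w h _ ih =>
    refine (derives_output (mem_grammar_rules.2 (.silent h q))).trans ?_
    rw [List.map_append]
    exact ih.append_left _
  | @pair p p' q' q'' q σ τ x b w w' h _ h' _ ih ih' =>
    refine (derives_output (mem_grammar_rules.2 (.pair h h' q))).trans ?_
    simp only [List.map_append]
    exact (((ih.append_left _).append_right _).append_right _).trans (ih'.append_left _)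

theorem language_grammar (A : LetterAutomaton α X Q) : A.grammar.language = A.language := by
  refine le_antisymm ?_ ?_
  · exact language_le_of_formLanguage_le (K := A.nonterminalLanguage) fun r hr =>
      (mem_grammar_rules.1 hr).formLanguage_le
  · rintro w ⟨q, hq, h⟩
    exact (derives_output (mem_grammar_rules.2 (.entry hq))).trans h.derives

end Grammar

end LetterAutomaton

instance finite_subtype_length_le (T : Type*) [Finite T] (N : ℕ) :
    Finite {l : List T // l.length ≤ N} :=
  List.finite_length_le T N

namespace ExtendedFA

variable {α X Q : Type*}

theorem exists_length_le_of_mem_step [Finite α] [Finite Q] (M : ExtendedFA (FreeGroup X) α Q) :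
    ∃ N, ∀ q σ s, s ∈ M.step q σ → ∃ l : List (X × Bool), l.length ≤ N ∧ FreeGroup.mk l = s.2 := by
  classical
  have hfin : (⋃ q, ⋃ σ, (M.step q σ : Set (Q × FreeGroup X))).Finite :=
    Set.finite_iUnion fun q => Set.finite_iUnion fun σ => (M.step q σ).finite_toSet
  obtain ⟨N, hN⟩ := (hfin.image fun s => s.2.toWord.length).bddAbove
  refine ⟨N, fun q σ s hs => ⟨s.2.toWord, hN ⟨s, ?_, rfl⟩, FreeGroup.mk_toWord⟩⟩
  exact Set.mem_iUnion₂.2 ⟨q, σ, hs⟩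

/-- The transitions of `M.subdivision N`: a transition of `M` stores a word for the element by which
it multiplies the register, and the letters of the stored word are then emitted one by one. -/
inductive SubdivisionStep (M : ExtendedFA (FreeGroup X) α Q) (N : ℕ) :
    Q × {l : List (X × Bool) // l.length ≤ N} → Option α → Option (X × Bool) →
      Q × {l : List (X × Bool) // l.length ≤ N} → Prop
  | load {q q' : Q} {σ : Option α} {l : List (X × Bool)} (h : (q', FreeGroup.mk l) ∈ M.step q σ)
      (hl : l.length ≤ N) : SubdivisionStep M N (q, ⟨[], N.zero_le⟩) σ none (q', ⟨l, hl⟩)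
  | emit (q : Q) {c : X × Bool} {l : List (X × Bool)} (h : (c :: l).length ≤ N)
      (h' : l.length ≤ N) : SubdivisionStep M N (q, ⟨c :: l, h⟩) none (some c) (q, ⟨l, h'⟩)

/-- The automaton that simulates `M` letter by letter, provided that `M` multiplies its register
only by elements represented by words of length at most `N`. Its states record the letters that
are still to be emitted. -/
def subdivision (M : ExtendedFA (FreeGroup X) α Q) (N : ℕ) :
    LetterAutomaton α X (Q × {l : List (X × Bool) // l.length ≤ N}) where
  Step := M.SubdivisionStep N
  start := (M.start, ⟨[], N.zero_le⟩)
  accept := (fun q => (q, ⟨[], N.zero_le⟩)) '' M.accept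

variable [Finite X] [Finite Q] {M : ExtendedFA (FreeGroup X) α Q} {N : ℕ}

theorem run_of_subdivision_run {s : Q × {l : List (X × Bool) // l.length ≤ N}} {r : Q}
    {x y : FreeGroup X} {w : List α}
    (h : (M.subdivision N).toFA.Run s x w (r, ⟨[], N.zero_le⟩) y) :
    M.Run s.1 (x * FreeGroup.mk s.2) w r y := by
  induction h using Run.step_induction_on with
  | refl => simpa [← FreeGroup.one_eq_mk] using Run.refl r y
  | step hs _ ih =>
    obtain ⟨c, hc, rfl⟩ := LetterAutomaton.mem_toFA_step.1 hs
    cases hc with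
    | load h hl =>
      refine .step h ?_
      simpa [← FreeGroup.one_eq_mk] using ih
    | emit q h h' => simpa [mul_assoc, FreeGroup.mul_mk] using ih

theorem subdivision_run_emit {q : Q} {l : List (X × Bool)} (hl : l.length ≤ N)
    {s : Q × {l : List (X × Bool) // l.length ≤ N}} {x y : FreeGroup X} {w : List α}
    (h : (M.subdivision N).toFA.Run (q, ⟨[], N.zero_le⟩) (x * FreeGroup.mk l) w s y) :
    (M.subdivision N).toFA.Run (q, ⟨l, hl⟩) x w s y := by
  induction l generalizing x with
  | nil => simpa [← FreeGroup.one_eq_mk] using h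
  | cons c l ih =>
    have hl' : l.length ≤ N := (Nat.le_succ _).trans hl
    refine .eps (LetterAutomaton.mem_toFA_step.2 ⟨some c, .emit q hl hl', rfl⟩) (ih hl' ?_)
    simpa [mul_assoc, FreeGroup.mul_mk] using h

theorem Run.subdivision_run
    (hN : ∀ q σ s, s ∈ M.step q σ → ∃ l : List (X × Bool), l.length ≤ N ∧ FreeGroup.mk l = s.2)
    {q r : Q} {x y : FreeGroup X} {w : List α} (h : M.Run q x w r y) :
    (M.subdivision N).toFA.Run (q, ⟨[], N.zero_le⟩) x w (r, ⟨[], N.zero_le⟩) y := by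
  induction h using Run.step_induction_on with
  | refl => exact .refl _ _
  | step h _ ih =>
    obtain ⟨l, hl, rfl⟩ := hN _ _ _ h
    refine .step (LetterAutomaton.mem_toFA_step.2 ⟨none, .load h hl, rfl⟩)
      (subdivision_run_emit hl ?_)
    simpa [← FreeGroup.one_eq_mk] using ih

theorem language_subdivision
    (hN : ∀ q σ s, s ∈ M.step q σ → ∃ l : List (X × Bool), l.length ≤ N ∧ FreeGroup.mk l = s.2) :
    (M.subdivision N).language = M.accepts := by
  rw [← LetterAutomaton.accepts_toFA]
  ext w
  constructor
  · rintro ⟨_, ⟨q, hq, rfl⟩, h⟩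
    have hrun : M.Run M.start (1 * FreeGroup.mk []) w q 1 := run_of_subdivision_run h
    rw [← FreeGroup.one_eq_mk, mul_one] at hrun
    exact ⟨q, hq, hrun⟩
  · rintro ⟨q, hq, h⟩
    exact ⟨_, ⟨q, hq, rfl⟩, h.subdivision_run hN⟩

end ExtendedFA

theorem groupAutomatonLanguages_freeGroup_subset (X : Type) [Finite X] (α : Type*) [Finite α] :
    groupAutomatonLanguages (FreeGroup X) α ⊆ contextFreeLanguages α := by
  rintro _ ⟨Q, hQ, M, rfl⟩
  obtain ⟨N, hN⟩ := M.exists_length_le_of_mem_step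
  rw [← M.language_subdivision hN, ← LetterAutomaton.language_grammar]
  exact ⟨_, rfl⟩

/-! ### The recursive descent parser -/

section Parser

variable {α : Type*} {g : ContextFreeGrammar α}

/-- The states of the recursive descent parser for `g`: the sentential forms that are still to be
matched in the rule which is currently applied. -/
def parserItems (g : ContextFreeGrammar α) : Set (List (Symbol α g.NT)) :=
  {s | s <:+ [.nonterminal g.initial] ∨ ∃ r ∈ g.rules, s <:+ r.output}

instance finite_parserItems (g : ContextFreeGrammar α) : Finite (parserItems g) := by
  have hfin (l : List (Symbol α g.NT)) : {s | s <:+ l}.Finite :=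
    l.tails.finite_toSet.subset fun s hs => (List.mem_tails s l).2 hs
  refine ((hfin [.nonterminal g.initial]).union
    (g.rules.finite_toSet.biUnion fun r _ => hfin r.output)).subset ?_
  rintro s (hs | ⟨r, hr, hs⟩)
  · exact .inl hs
  · exact .inr (Set.mem_biUnion hr hs)

theorem mem_parserItems_of_suffix {s t : List (Symbol α g.NT)} (hs : s ∈ parserItems g)
    (h : t <:+ s) : t ∈ parserItems g :=
  hs.imp h.trans fun ⟨r, hr, hrs⟩ => ⟨r, hr, h.trans hrs⟩

/-- The transitions of the recursive descent parser for `g`. Before a nonterminal is expanded, the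
form that has to be matched afterwards is pushed as a return address; a letter `(t, true)` pushes
`t` and a letter `(t, false)` pops it. -/
inductive ParserStep (g : ContextFreeGrammar α) :
    parserItems g → Option α → Option (parserItems g × Bool) → parserItems g → Prop
  | read {s t : parserItems g} {a : α} (h : s.1 = .terminal a :: t.1) :
      ParserStep g s (some a) none t
  | push {s t u : parserItems g} {r : ContextFreeRule α g.NT} (hr : r ∈ g.rules)
      (h : s.1 = .nonterminal r.input :: t.1) (hu : u.1 = r.output) :
      ParserStep g s none (some (t, true)) u
  | pop {s : parserItems g} (hs : s.1 = []) (t : parserItems g) :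
      ParserStep g s none (some (t, false)) t

/-- The recursive descent parser for `g`. -/
def parser (g : ContextFreeGrammar α) : LetterAutomaton α (parserItems g) (parserItems g) where
  Step := ParserStep g
  start := ⟨[.nonterminal g.initial], .inl (List.suffix_refl _)⟩
  accept := {s | s.1 = []}

theorem exists_derives_of_balanced {s t : parserItems g} {w : List α}
    (h : (parser g).Balanced s w t) : ∃ u, s.1 = u ++ t.1 ∧ g.Derives u (w.map .terminal) := by
  induction h with
  | nil s => exact ⟨[], rfl, .refl _⟩
  | silent h _ ih =>
    obtain ⟨u, hu, hd⟩ := ih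
    cases h with
    | @read _ a h => exact ⟨.terminal a :: u, by rw [h, hu]; rfl, hd.append_left [.terminal a]⟩
  | @pair _ _ _ _ _ _ _ _ b _ _ h _ h' _ ih ih' =>
    obtain ⟨u, hu, hd⟩ := ih
    obtain ⟨u', hu', hd'⟩ := ih'
    cases h with
    | @push _ _ r hr hs hr' =>
      cases h' with
      | pop hq =>
        rw [hq, List.append_nil, hr'] at hu
        refine ⟨.nonterminal r.input :: u', by rw [hs, hu']; rfl, ?_⟩
        have := (((derives_output hr).trans (hu ▸ hd)).append_right u').trans (hd'.append_left _)
        simpa using this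
    | pop hs =>
      -- The form `t` that was popped would be longer than itself if it was pushed afterwards.
      cases h' with
      | push _ hq _ =>
        have := congrArg List.length (hu.trans (congrArg (u ++ ·) hq))
        simp only [List.length_append, List.length_cons] at this
        omega

/-- The words that lead the parser past every occurrence of the nonterminal `A`. -/
def parsedLanguage (g : ContextFreeGrammar α) (A : g.NT) : Language α :=
  {w | ∀ s t : parserItems g, s.1 = .nonterminal A :: t.1 → (parser g).Balanced s w t}

theorem balanced_of_mem_formLanguage {s t : parserItems g} (ht : t.1 = []) {w : List α}
    (hw : w ∈ formLanguage (parsedLanguage g) s.1) : (parser g).Balanced s w t := by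
  obtain ⟨s, hs⟩ := s
  induction s generalizing w with
  | nil =>
    obtain rfl : w = [] := hw
    obtain rfl : t = ⟨[], hs⟩ := Subtype.ext ht
    exact .nil _
  | cons x s ih =>
    have hs' := mem_parserItems_of_suffix hs (List.suffix_cons x s)
    dsimp only at hw
    rw [formLanguage_cons] at hw
    obtain ⟨w₁, hw₁, w₂, hw₂, rfl⟩ := hw
    have hb := ih hs' hw₂
    match x with
    | .terminal a =>
      rw [formLanguage_terminal] at hw₁
      obtain rfl : w₁ = [a] := hw₁
      exact .silent (σ := some a) (.read rfl) hb
    | .nonterminal A =>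
      rw [formLanguage_nonterminal] at hw₁
      exact (hw₁ ⟨_, hs⟩ ⟨s, hs'⟩ rfl).trans hb

/-- The parser item reached when a rule has been matched completely. -/
def finishedItem (g : ContextFreeGrammar α) : parserItems g :=
  ⟨[], .inl List.nil_suffix⟩

theorem formLanguage_parsedLanguage_le {r : ContextFreeRule α g.NT} (hr : r ∈ g.rules) :
    formLanguage (parsedLanguage g) r.output ≤ parsedLanguage g r.input := by
  intro w hw s t hst
  let u : parserItems g := ⟨r.output, .inr ⟨r, hr, List.suffix_refl _⟩⟩
  have hb : (parser g).Balanced u w (finishedItem g) := balanced_of_mem_formLanguage rfl hw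
  simpa using LetterAutomaton.Balanced.pair (A := parser g) (ParserStep.push hr hst rfl) hb
    (ParserStep.pop rfl t) (.nil t)

theorem language_parser (g : ContextFreeGrammar α) : (parser g).language = g.language := by
  refine le_antisymm ?_ fun w hw => ⟨finishedItem g, rfl, ?_⟩
  · rintro w ⟨t, ht, h⟩
    obtain ⟨u, hu, hd⟩ := exists_derives_of_balanced h
    rw [show t.1 = [] from ht, List.append_nil] at hu
    subst hu
    exact hd
  · have hw' := language_le_of_formLanguage_le (fun _ => formLanguage_parsedLanguage_le) hw
    exact hw' _ _ rfl

end Parser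

/-! ### Free subgroups of the free group of rank two -/

section Embedding

/-- The action of `ℤ` on the free group on `ℤ` by translation of the generators. -/
def translateGenerators : Multiplicative ℤ →* MulAut (FreeGroup ℤ) where
  toFun n := FreeGroup.freeGroupCongr (Equiv.addLeft n.toAdd)
  map_one' := by ext; simp
  map_mul' m n := by ext; simp [FreeGroup.map.comp, Function.comp_def]

theorem translateGenerators_of (n : Multiplicative ℤ) (k : ℤ) :
    translateGenerators n (.of k) = .of (n.toAdd + k) := by
  simp [translateGenerators]

/-- The homomorphism from the free group of countably infinite rank to the free group on `a` and `b`
that maps the generator `n` to the conjugate of `b` by `a ^ n`. -/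
def conjugatesHom : FreeGroup ℤ →* FreeGroup (Fin 2) :=
  FreeGroup.lift fun n => .of 0 ^ n * .of 1 * (.of 0 ^ n)⁻¹

/-- The homomorphism that maps the generator `a` of the free group on `a` and `b` to the generator
of the acting group `ℤ` and `b` to the generator `0`. -/
def toSemidirectProduct :
    FreeGroup (Fin 2) →* FreeGroup ℤ ⋊[translateGenerators] Multiplicative ℤ :=
  FreeGroup.lift ![SemidirectProduct.inr (Multiplicative.ofAdd 1), SemidirectProduct.inl (.of 0)]

theorem toSemidirectProduct_comp_conjugatesHom :
    toSemidirectProduct.comp conjugatesHom = SemidirectProduct.inl := by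
  ext1 n
  have htranslate : translateGenerators (Multiplicative.ofAdd 1 ^ n) (.of 0) = .of n := by
    rw [translateGenerators_of]
    simp
  rw [MonoidHom.comp_apply, ← htranslate, SemidirectProduct.inl_aut, htranslate]
  simp [toSemidirectProduct, conjugatesHom]

theorem conjugatesHom_injective : Function.Injective conjugatesHom := by
  refine Function.Injective.of_comp (f := toSemidirectProduct) ?_
  rw [← MonoidHom.coe_comp, toSemidirectProduct_comp_conjugatesHom]
  exact SemidirectProduct.inl_injective

theorem exists_injective_freeGroup_fin_two (X : Type*) [Countable X] :
    ∃ f : FreeGroup X →* FreeGroup (Fin 2), Function.Injective f := by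
  obtain ⟨i, hi⟩ := exists_injective_nat X
  exact ⟨conjugatesHom.comp (FreeGroup.map fun x => (i x : ℤ)),
    conjugatesHom_injective.comp (FreeGroup.map_injective (Nat.cast_injective.comp hi))⟩

end Embedding

theorem contextFreeLanguages_subset_groupAutomatonLanguages_freeGroup (α : Type*) :
    contextFreeLanguages α ⊆ groupAutomatonLanguages (FreeGroup (Fin 2)) α := by
  rintro _ ⟨g, rfl⟩
  obtain ⟨f, hf⟩ := exists_injective_freeGroup_fin_two (parserItems g)
  refine groupAutomatonLanguages_subset_of_injective hf α ?_
  rw [← language_parser, ← LetterAutomaton.accepts_toFA]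
  exact ExtendedFA.accepts_mem_groupAutomatonLanguages _

/-! ### Free subgroups of finite index in `SL(2, ℤ)` -/

open scoped Function Pointwise in
theorem freeGroup_lift_injective_of_zpow_ping_pong {ι G β : Type*} [Nontrivial ι] [Group G]
    [MulAction G β] (a : ι → G) (X : ι → Set β) (hX : ∀ i, (X i).Nonempty)
    (hdisj : Pairwise (Disjoint on X))
    (hpp : Pairwise fun i j => ∀ n : ℤ, n ≠ 0 → a i ^ n • X j ⊆ X i) :
    Function.Injective (FreeGroup.lift a) := by
  have hlift : FreeGroup.lift a =
      (Monoid.CoprodI.lift fun i => FreeGroup.lift fun _ : Unit => a i).comp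
        freeGroupEquivCoprodI.toMonoidHom := by
    ext i
    simp
  have hcard : 3 ≤ Cardinal.mk (FreeGroup Unit) := by
    rw [FreeGroup.freeGroupUnitEquivInt.cardinal_eq, Cardinal.mk_denumerable]
    exact Cardinal.natCast_le_aleph0 (n := 3)
  rw [hlift, MonoidHom.coe_comp]
  refine Function.Injective.comp ?_ freeGroupEquivCoprodI.injective
  refine Monoid.CoprodI.lift_injective_of_ping_pong _ (.inr ?_) X hX hdisj ?_
  · exact ⟨Classical.arbitrary ι, hcard⟩
  · intro i j hij
    refine FreeGroup.freeGroupUnitEquivInt.forall_congr_left.2 fun n hn => ?_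
    change FreeGroup.lift (fun _ => a i) (FreeGroup.of () ^ n) • X j ⊆ X i
    rw [map_zpow, FreeGroup.lift_apply_of]
    exact hpp hij n (by rintro rfl; exact hn (zpow_zero _))

open Matrix.SpecialLinearGroup in
theorem transvection_zpow {n R : Type*} [DecidableEq n] [Fintype n] [CommRing R] {i j : n}
    (hij : i ≠ j) (b : R) (k : ℤ) : transvection hij b ^ k = transvection hij (k * b) := by
  induction k with
  | zero => simp [transvection_coeff_zero]
  | succ k ih =>
    rw [zpow_add_one, ih, ← transvection_add]
    congr 1
    push_cast
    ring
  | pred k ih =>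
    rw [zpow_sub_one, ih, transvection_inv, ← transvection_add]
    congr 1
    push_cast
    ring

open Matrix.SpecialLinearGroup in
theorem transvection_smul {n R : Type*} [DecidableEq n] [Fintype n] [CommRing R] {i j : n}
    (hij : i ≠ j) (b : R) (v : n → R) :
    transvection hij b • v = v + Pi.single i (b * v j) := by
  rw [Matrix.SpecialLinearGroup.smul_def, Matrix.smul_eq_mulVec, transvection_coe,
    Matrix.add_mulVec, Matrix.one_mulVec, Matrix.single_mulVec_eq, ← Pi.single_smul, smul_eq_mul,
    mul_one]

theorem finiteIndex_range_toGL (n R : Type*) [DecidableEq n] [Fintype n] [CommRing R]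
    [Finite Rˣ] : (Matrix.SpecialLinearGroup.toGL (n := n) (R := R)).range.FiniteIndex := by
  refine Subgroup.finiteIndex_of_le (H := Matrix.GeneralLinearGroup.det.ker) fun A hA => ?_
  exact ⟨⟨A, congrArg Units.val hA⟩, Units.ext rfl⟩

section Sanov

open Matrix

/-- The generators `!![1, 2; 0, 1]` and `!![1, 0; 2, 1]` of the Sanov subgroup of `SL(2, ℤ)`. The
index other than `i : Fin 2` is written `i + 1`, so that both generators are treated at once. -/
def sanovGen (i : Fin 2) : SpecialLinearGroup (Fin 2) ℤ :=
  SpecialLinearGroup.transvection (show i ≠ i + 1 by decide +revert) 2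

theorem sanovGen_zpow_smul_apply_self (i : Fin 2) (k : ℤ) (v : Fin 2 → ℤ) :
    (sanovGen i ^ k • v) i = v i + 2 * k * v (i + 1) := by
  rw [sanovGen, transvection_zpow, transvection_smul]
  simp [mul_comm]

theorem sanovGen_zpow_smul_apply_add_one (i : Fin 2) (k : ℤ) (v : Fin 2 → ℤ) :
    (sanovGen i ^ k • v) (i + 1) = v (i + 1) := by
  rw [sanovGen, transvection_zpow, transvection_smul]
  simp

theorem sanovGen_zpow_mul_apply_self (i j : Fin 2) (k : ℤ) (A : SpecialLinearGroup (Fin 2) ℤ) :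
    (sanovGen i ^ k * A) i j = A i j + 2 * k * A (i + 1) j :=
  sanovGen_zpow_smul_apply_self i k fun r => A r j

theorem sanovGen_zpow_mul_apply_add_one (i j : Fin 2) (k : ℤ)
    (A : SpecialLinearGroup (Fin 2) ℤ) : (sanovGen i ^ k * A) (i + 1) j = A (i + 1) j :=
  sanovGen_zpow_smul_apply_add_one i k fun r => A r j

theorem fin_two_eq_or_eq_add_one (i j : Fin 2) : j = i ∨ j = i + 1 := by decide +revert

theorem abs_lt_abs_add_two_mul_mul {a c k : ℤ} (h : |a| < |c|) (hk : k ≠ 0) :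
    |c| < |a + 2 * k * c| := by
  have hkc : |c| ≤ |k * c| := by
    rw [abs_mul]
    exact le_mul_of_one_le_left (abs_nonneg c) (Int.one_le_abs hk)
  have : |2 * k * c| ≤ |a + 2 * k * c| + |a| := by
    simpa using abs_sub (a + 2 * k * c) a
  rw [mul_assoc] at this ⊢
  rw [abs_mul, abs_two] at this
  linarith

open scoped Pointwise in
theorem sanovGen_lift_injective : Function.Injective (FreeGroup.lift sanovGen) := by
  refine freeGroup_lift_injective_of_zpow_ping_pong sanovGen
    (fun i => {v : Fin 2 → ℤ | |v (i + 1)| < |v i|}) (fun i => ⟨Pi.single i 1, by simp⟩) ?_ ?_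
  · intro i j hij
    obtain rfl := (fin_two_eq_or_eq_add_one i j).resolve_left hij.symm
    refine Set.disjoint_left.2 fun v (hi : |v (i + 1)| < |v i|) hj => hi.asymm ?_
    simpa [add_assoc] using hj
  · intro i j hij k hk
    obtain rfl := (fin_two_eq_or_eq_add_one i j).resolve_left hij.symm
    rintro _ ⟨v, hv, rfl⟩
    simp only [Set.mem_ofPred_eq, sanovGen_zpow_smul_apply_self, sanovGen_zpow_smul_apply_add_one]
    refine abs_lt_abs_add_two_mul_mul ?_ hk
    simpa [add_assoc] using hv

/-- The congruences that cut out the Sanov subgroup of `SL(2, ℤ)`: the diagonal entries are `1`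
modulo `4` and the other entries are even. -/
def IsSanov (A : SpecialLinearGroup (Fin 2) ℤ) : Prop :=
  ∀ i, A i i ≡ 1 [ZMOD 4] ∧ Even (A i (i + 1))

theorem IsSanov.sanovGen_zpow_mul {A : SpecialLinearGroup (Fin 2) ℤ} (hA : IsSanov A) (i : Fin 2)
    (k : ℤ) : IsSanov (sanovGen i ^ k * A) := by
  have hi : i + 1 + 1 = i := by decide +revert
  intro j
  obtain rfl | rfl := fin_two_eq_or_eq_add_one i j
  · rw [sanovGen_zpow_mul_apply_self, sanovGen_zpow_mul_apply_self]
    obtain ⟨m, hm⟩ : Even (A (j + 1) j) := by simpa only [hi] using (hA (j + 1)).2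
    refine ⟨?_, (hA j).2.add ((even_two.mul_right k).mul_right _)⟩
    rw [hm, show A j j + 2 * k * (m + m) = A j j + 4 * (k * m) by ring]
    simpa [Int.ModEq] using (hA j).1
  · rw [sanovGen_zpow_mul_apply_add_one, sanovGen_zpow_mul_apply_add_one]
    exact hA (i + 1)

theorem exists_natAbs_add_two_mul_mul_lt {a c : ℤ} (hc : c ≠ 0) (h : c.natAbs < a.natAbs) :
    ∃ k, (a + 2 * k * c).natAbs < a.natAbs := by
  by_cases hac : 0 ≤ a ↔ 0 ≤ c
  · exact ⟨-1, by omega⟩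
  · exact ⟨1, by omega⟩

theorem IsSanov.eq_zpow_of_apply_eq_zero {A : SpecialLinearGroup (Fin 2) ℤ} (hA : IsSanov A)
    (h : A 1 0 = 0) : A = sanovGen 0 ^ (A 0 1 / 2) := by
  have hdet := A.det_coe
  rw [det_fin_two, h, mul_zero, sub_zero] at hdet
  have h00 : A 0 0 = 1 := by
    refine (Int.eq_one_or_neg_one_of_mul_eq_one hdet).resolve_right fun h => ?_
    exact absurd (h ▸ (hA 0).1) (by decide)
  have h11 : A 1 1 = 1 := by rwa [h00, one_mul] at hdet
  have hself (j : Fin 2) := sanovGen_zpow_mul_apply_self 0 j (A 0 1 / 2) 1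
  have hadd (j : Fin 2) := sanovGen_zpow_mul_apply_add_one 0 j (A 0 1 / 2) 1
  rw [mul_one] at hself hadd
  ext i j
  obtain rfl | rfl := fin_two_eq_or_eq_add_one 0 i
  · rw [hself]
    fin_cases j
    · simp [h00]
    · have : 2 * (A 0 1 / 2) = A 0 1 := Int.mul_ediv_cancel' (hA 0).2.two_dvd
      simp [this]
  · rw [hadd]
    fin_cases j <;> simp [h, h11]

/-- Euclidean descent on the first column. -/
theorem IsSanov.mem_range {A : SpecialLinearGroup (Fin 2) ℤ} (hA : IsSanov A) :
    A ∈ (FreeGroup.lift sanovGen).range := by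
  induction hn : (A 0 0).natAbs + (A 1 0).natAbs using Nat.strong_induction_on generalizing A with
  | _ n ih =>
  have hgen (i : Fin 2) (k : ℤ) : sanovGen i ^ k ∈ (FreeGroup.lift sanovGen).range :=
    zpow_mem (MonoidHom.mem_range.2 ⟨.of i, FreeGroup.lift_apply_of⟩) k
  by_cases hc : A 1 0 = 0
  · rw [hA.eq_zpow_of_apply_eq_zero hc]
    exact hgen _ _
  · obtain ⟨i, hi, hlt⟩ :
        ∃ i : Fin 2, A (i + 1) 0 ≠ 0 ∧ (A (i + 1) 0).natAbs < (A i 0).natAbs := by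
      have h00 : A 0 0 % 4 = 1 := (hA 0).1
      have h10 : A 1 0 % 2 = 0 := Int.even_iff.1 (hA 1).2
      rw [Fin.exists_fin_two]
      simp only [zero_add, show (1 + 1 : Fin 2) = 0 from rfl]
      omega
    obtain ⟨k, hk⟩ := exists_natAbs_add_two_mul_mul_lt hi hlt
    rw [← mul_mem_cancel_left (hgen i k)]
    refine ih _ ?_ (hA.sanovGen_zpow_mul i k) rfl
    have hsum (B : SpecialLinearGroup (Fin 2) ℤ) : (B 0 0).natAbs + (B 1 0).natAbs =
        (B i 0).natAbs + (B (i + 1) 0).natAbs := by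
      fin_cases i <;> simp [add_comm]
    rw [← hn, hsum, hsum A, sanovGen_zpow_mul_apply_self, sanovGen_zpow_mul_apply_add_one]
    omega

theorem gamma_four_le_range_lift_sanovGen :
    CongruenceSubgroup.Gamma 4 ≤ (FreeGroup.lift sanovGen).range := by
  intro A hA
  obtain ⟨h00, h01, h10, h11⟩ := CongruenceSubgroup.Gamma_mem.1 hA
  have modEq_one {a : ℤ} (h : (a : ZMod 4) = 1) : a ≡ 1 [ZMOD 4] :=
    (ZMod.intCast_eq_intCast_iff a 1 4).1 (by simpa using h)
  have even {a : ℤ} (h : (a : ZMod 4) = 0) : Even a :=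
    even_iff_two_dvd.2 <| (show (2 : ℤ) ∣ 4 by decide).trans <|
      (ZMod.intCast_zmod_eq_zero_iff_dvd a 4).1 h
  exact IsSanov.mem_range <| Fin.forall_fin_two.2
    ⟨⟨modEq_one h00, even h01⟩, modEq_one h11, even h10⟩

instance finiteIndex_range_lift_sanovGen : (FreeGroup.lift sanovGen).range.FiniteIndex :=
  Subgroup.finiteIndex_of_le gamma_four_le_range_lift_sanovGen

end Sanov

theorem mainTheorem1 (α : Type*) [Finite α] :
    contextFreeLanguages α = groupAutomatonLanguages (FreeGroup (Fin 2)) α ∧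
    groupAutomatonLanguages (FreeGroup (Fin 2)) α =
      groupAutomatonLanguages (Matrix.SpecialLinearGroup (Fin 2) ℤ) α ∧
    groupAutomatonLanguages (Matrix.SpecialLinearGroup (Fin 2) ℤ) α =
      groupAutomatonLanguages (Matrix.GeneralLinearGroup (Fin 2) ℤ) α := by
  refine ⟨?_, ?_, ?_⟩
  · exact (contextFreeLanguages_subset_groupAutomatonLanguages_freeGroup α).antisymm
      (groupAutomatonLanguages_freeGroup_subset (Fin 2) α)
  · exact groupAutomatonLanguages_eq_of_finiteIndex_range sanovGen_lift_injective α
  · have := finiteIndex_range_toGL (Fin 2) ℤ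
    exact groupAutomatonLanguages_eq_of_finiteIndex_range
      Matrix.SpecialLinearGroup.toGL_injective α
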